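/- Let $n$ be a natural number and let $A(n,1)$ be the space of affine lines in $\mathbb{R}^n$. Every $\ell\in A(n,1)$ can be written as $\ell=\langle e\rangle+v$ with $|e|=1$ and $v\perp e$, where $v$ is unique and $e$ is unique up to sign; equip $A(n,1)$ with the metric $$d(\langle e_1\rangle+v_1,\langle e_2\rangle+v_2)=\min\{|e_1-e_2|,|e_1+e_2|\}+|v_1-v_2|,$$ and let $\mathcal{H}^s$ denote $s$-dimensional Hausdorff (outer) measure, on $A(n,1)$ and on $\mathbb{R}^n$. For $\alpha\in(0,1]$ and $\beta\in(0,2n-2]$, a set $E\subset\mathbb{R}^n$ is called an $(\alpha,\beta)$-Furstenberg set if there is a set of lines $L\subset A(n,1)$ with $\mathcal{H}^\beta(L)>0$ such that $\mathcal{H}^\alpha(E\cap\omega)>0$ for every $\omega\in L$. (No measurability of $E$ or $L$ is assumed.) **Theorem.** Let $\alpha\in(0,1]$, $\beta\in(0,2n-2]$, and let $E\subset\mathbb{R}^n$ be an $(\alpha,\beta)$-Furstenberg set. Then $$\dim_H E\ \ge\ \alpha+\min\{\beta,\alpha\}.$$ -/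

import Mathlib

open MeasureTheory

namespace Furstenberg

/-- The space `A(n,1)` of affine lines in `ℝⁿ`: the one-dimensional affine subspaces. -/
@[ext]
structure AffineLine (n : ℕ) where
  /-- The line as an affine subspace. -/
  toAffineSubspace : AffineSubspace ℝ (EuclideanSpace ℝ (Fin n))
  /-- It is one-dimensional; in particular it is non-empty. -/
  finrank_direction : Module.finrank ℝ toAffineSubspace.direction = 1

namespace AffineLine

variable {n : ℕ}

/-- The set of points of a line. -/
def points (ℓ : AffineLine n) : Set (EuclideanSpace ℝ (Fin n)) :=
  (ℓ.toAffineSubspace : Set (EuclideanSpace ℝ (Fin n)))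

/-- `ℓ = ⟨e⟩ + v` with `e` a unit vector and `v` orthogonal to `e`. -/
structure IsParam (ℓ : AffineLine n) (e v : EuclideanSpace ℝ (Fin n)) : Prop where
  norm_eq : ‖e‖ = 1
  inner_eq : inner ℝ e v = 0
  points_eq : ℓ.points = {x | ∃ t : ℝ, x = t • e + v}

/-- The distance `|e₁ - e₂| + |v₁ - v₂|` between the lines `⟨e₁⟩ + v₁` and `⟨e₂⟩ + v₂`, with
`eᵢ` of norm one and `vᵢ` orthogonal to `eᵢ`. Since `eᵢ` is determined by the line only up to its
sign, the infimum (a minimum, see `lineDist_eq`) over all such representations is taken. -/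
noncomputable def lineDist (ℓ₁ ℓ₂ : AffineLine n) : ℝ :=
  sInf {r | ∃ e₁ v₁ e₂ v₂ : EuclideanSpace ℝ (Fin n),
    ℓ₁.IsParam e₁ v₁ ∧ ℓ₂.IsParam e₂ v₂ ∧ r = ‖e₁ - e₂‖ + ‖v₁ - v₂‖}

theorem exists_isParam (ℓ : AffineLine n) : ∃ e v, ℓ.IsParam e v := by
  obtain ⟨u, hu, hspan⟩ := finrank_eq_one_iff'.mp ℓ.finrank_direction
  have hu' : (u : EuclideanSpace ℝ (Fin n)) ≠ 0 := fun h => hu (Subtype.ext h)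
  have hne : (ℓ.toAffineSubspace : Set (EuclideanSpace ℝ (Fin n))).Nonempty := by
    rw [Set.nonempty_iff_ne_empty]
    intro h
    have hbot : ℓ.toAffineSubspace = ⊥ := by
      apply SetLike.coe_injective
      simpa using h
    have h1 := ℓ.finrank_direction
    rw [hbot, AffineSubspace.direction_bot, finrank_bot] at h1
    exact absurd h1 (by norm_num)
  obtain ⟨p, hp⟩ := hne
  set w : EuclideanSpace ℝ (Fin n) := (u : EuclideanSpace ℝ (Fin n)) with hw
  set e := (‖w‖⁻¹ : ℝ) • w with he
  have hnw : ‖w‖ ≠ 0 := norm_ne_zero_iff.mpr hu'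
  have he1 : ‖e‖ = 1 := by
    rw [he, norm_smul, norm_inv, norm_norm, inv_mul_cancel₀ hnw]
  have hwe : w = ‖w‖ • e := by
    rw [he, smul_smul, mul_inv_cancel₀ hnw, one_smul]
  have hed : e ∈ ℓ.toAffineSubspace.direction :=
    ℓ.toAffineSubspace.direction.smul_mem _ u.2
  refine ⟨e, p - (inner ℝ e p : ℝ) • e, he1, ?_, ?_⟩
  · rw [inner_sub_right, inner_smul_right, real_inner_self_eq_norm_sq, he1]
    ring
  · ext x
    constructor
    · intro hx
      have hxp : x -ᵥ p ∈ ℓ.toAffineSubspace.direction :=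
        AffineSubspace.vsub_mem_direction hx hp
      obtain ⟨c, hc⟩ := hspan ⟨x -ᵥ p, hxp⟩
      have hc' : c • w = x - p := congrArg Subtype.val hc
      refine ⟨c * ‖w‖ + inner ℝ e p, ?_⟩
      have : x = c • w + p := by rw [hc']; abel
      rw [add_smul, mul_smul, ← hwe, this]
      abel
    · rintro ⟨t, rfl⟩
      have : t • e + (p - (inner ℝ e p : ℝ) • e) = ((t - inner ℝ e p) • e) +ᵥ p := by
        rw [vadd_eq_add, sub_smul]
        abel
      rw [this]
      exact AffineSubspace.vadd_mem_of_mem_direction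
        (ℓ.toAffineSubspace.direction.smul_mem _ hed) hp

theorem IsParam.neg {ℓ : AffineLine n} {e v : EuclideanSpace ℝ (Fin n)} (h : ℓ.IsParam e v) :
    ℓ.IsParam (-e) v := by
  refine ⟨by rw [norm_neg, h.norm_eq], by rw [inner_neg_left, h.inner_eq, neg_zero], ?_⟩
  rw [h.points_eq]
  ext x
  constructor
  · rintro ⟨t, rfl⟩
    exact ⟨-t, by simp⟩
  · rintro ⟨t, rfl⟩
    exact ⟨-t, by simp⟩

/-- The vector `v` is determined by the line, and `e` is determined up to sign. -/
theorem IsParam.unique {ℓ : AffineLine n} {e v e' v' : EuclideanSpace ℝ (Fin n)}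
    (h : ℓ.IsParam e v) (h' : ℓ.IsParam e' v') : v' = v ∧ (e' = e ∨ e' = -e) := by
  have mem : ∀ t : ℝ, ∃ s : ℝ, t • e' + v' = s • e + v := by
    intro t
    have hx : t • e' + v' ∈ ℓ.points := by
      rw [h'.points_eq]
      exact ⟨t, rfl⟩
    rw [h.points_eq] at hx
    exact hx
  obtain ⟨s0, hs0⟩ := mem 0
  obtain ⟨s1, hs1⟩ := mem 1
  rw [zero_smul, zero_add] at hs0
  rw [one_smul] at hs1
  have hee : e' = (s1 - s0) • e := by
    have : e' = (e' + v') - v' := by abel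
    rw [this, hs1, hs0, sub_smul]
    abel
  have habs : |s1 - s0| = 1 := by
    have := h'.norm_eq
    rwa [hee, norm_smul, h.norm_eq, mul_one, Real.norm_eq_abs] at this
  have hs : (s1 - s0) * s0 = 0 := by
    have := h'.inner_eq
    rw [hs0, hee, inner_add_right, inner_smul_left, inner_smul_right, inner_smul_left,
      h.inner_eq, real_inner_self_eq_norm_sq, h.norm_eq] at this
    simpa using this
  have hne : s1 - s0 ≠ 0 := by
    intro h0
    rw [h0] at habs
    simp at habs
  have h00 : s0 = 0 := (mul_eq_zero.mp hs).resolve_left hne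
  refine ⟨by rw [hs0, h00, zero_smul, zero_add], ?_⟩
  rcases eq_or_eq_neg_of_abs_eq habs with h1 | h1
  · left
    rw [hee, h1, one_smul]
  · right
    rw [hee, h1, neg_smul, one_smul]

theorem lineDist_eq {ℓ₁ ℓ₂ : AffineLine n} {e₁ v₁ e₂ v₂ : EuclideanSpace ℝ (Fin n)}
    (h₁ : ℓ₁.IsParam e₁ v₁) (h₂ : ℓ₂.IsParam e₂ v₂) :
    lineDist ℓ₁ ℓ₂ = min ‖e₁ - e₂‖ ‖e₁ + e₂‖ + ‖v₁ - v₂‖ := by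
  refine IsLeast.csInf_eq ⟨?_, ?_⟩
  · rcases min_choice ‖e₁ - e₂‖ ‖e₁ + e₂‖ with h | h
    · exact ⟨e₁, v₁, e₂, v₂, h₁, h₂, by rw [h]⟩
    · exact ⟨e₁, v₁, -e₂, v₂, h₁, h₂.neg, by rw [h, sub_neg_eq_add]⟩
  · rintro r ⟨a₁, w₁, a₂, w₂, k₁, k₂, rfl⟩
    obtain ⟨rfl, ha₁⟩ := h₁.unique k₁
    obtain ⟨rfl, ha₂⟩ := h₂.unique k₂
    gcongr
    rcases ha₁ with rfl | rfl <;> rcases ha₂ with rfl | rfl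
    · exact min_le_left _ _
    · rw [sub_neg_eq_add]
      exact min_le_right _ _
    · refine (min_le_right _ _).trans (le_of_eq ?_)
      rw [← norm_neg]
      congr 1
      abel
    · refine (min_le_left _ _).trans (le_of_eq ?_)
      rw [← norm_neg]
      congr 1
      abel

theorem lineDist_self (ℓ : AffineLine n) : lineDist ℓ ℓ = 0 := by
  obtain ⟨e, v, h⟩ := ℓ.exists_isParam
  rw [lineDist_eq h h]
  simp

theorem lineDist_comm (ℓ₁ ℓ₂ : AffineLine n) : lineDist ℓ₁ ℓ₂ = lineDist ℓ₂ ℓ₁ := by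
  obtain ⟨e₁, v₁, h₁⟩ := ℓ₁.exists_isParam
  obtain ⟨e₂, v₂, h₂⟩ := ℓ₂.exists_isParam
  rw [lineDist_eq h₁ h₂, lineDist_eq h₂ h₁, norm_sub_rev e₁, norm_sub_rev v₁, add_comm e₁]

theorem exists_lineDist_eq {ℓ₁ ℓ₂ : AffineLine n} {e₁ v₁ : EuclideanSpace ℝ (Fin n)}
    (h₁ : ℓ₁.IsParam e₁ v₁) :
    ∃ e₂ v₂, ℓ₂.IsParam e₂ v₂ ∧ lineDist ℓ₁ ℓ₂ = ‖e₁ - e₂‖ + ‖v₁ - v₂‖ := by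
  obtain ⟨e₂, v₂, h₂⟩ := ℓ₂.exists_isParam
  rcases min_choice ‖e₁ - e₂‖ ‖e₁ + e₂‖ with h | h
  · exact ⟨e₂, v₂, h₂, by rw [lineDist_eq h₁ h₂, h]⟩
  · exact ⟨-e₂, v₂, h₂.neg, by rw [lineDist_eq h₁ h₂, h, sub_neg_eq_add]⟩

theorem lineDist_triangle (ℓ₁ ℓ₂ ℓ₃ : AffineLine n) :
    lineDist ℓ₁ ℓ₃ ≤ lineDist ℓ₁ ℓ₂ + lineDist ℓ₂ ℓ₃ := by
  obtain ⟨e₁, v₁, h₁⟩ := ℓ₁.exists_isParam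
  obtain ⟨e₂, v₂, h₂, h12⟩ := exists_lineDist_eq (ℓ₂ := ℓ₂) h₁
  obtain ⟨e₃, v₃, h₃, h23⟩ := exists_lineDist_eq (ℓ₂ := ℓ₃) h₂
  rw [h12, h23, lineDist_eq h₁ h₃]
  have a := norm_sub_le_norm_sub_add_norm_sub e₁ e₂ e₃
  have b := norm_sub_le_norm_sub_add_norm_sub v₁ v₂ v₃
  have c := min_le_left ‖e₁ - e₃‖ ‖e₁ + e₃‖
  linarith

theorem eq_of_lineDist_eq_zero {ℓ₁ ℓ₂ : AffineLine n} (h : lineDist ℓ₁ ℓ₂ = 0) : ℓ₁ = ℓ₂ := by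
  obtain ⟨e₁, v₁, h₁⟩ := ℓ₁.exists_isParam
  obtain ⟨e₂, v₂, h₂, h12⟩ := exists_lineDist_eq (ℓ₂ := ℓ₂) h₁
  rw [h] at h12
  have a := norm_nonneg (e₁ - e₂)
  have b := norm_nonneg (v₁ - v₂)
  have he : e₁ = e₂ := sub_eq_zero.mp (norm_eq_zero.mp (by linarith))
  have hv : v₁ = v₂ := sub_eq_zero.mp (norm_eq_zero.mp (by linarith))
  apply AffineLine.ext
  apply SetLike.coe_injective
  change ℓ₁.points = ℓ₂.points
  rw [h₁.points_eq, h₂.points_eq, he, hv]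

/-- `A(n,1)` as a metric space. -/
noncomputable instance instMetricSpace : MetricSpace (AffineLine n) where
  dist := lineDist
  dist_self := lineDist_self
  dist_comm := lineDist_comm
  dist_triangle := lineDist_triangle
  eq_of_dist_eq_zero := eq_of_lineDist_eq_zero

/-- `A(n,1)` carries its Borel σ-algebra. -/
noncomputable instance instMeasurableSpace : MeasurableSpace (AffineLine n) := borel _

instance instBorelSpace : BorelSpace (AffineLine n) := ⟨rfl⟩

end AffineLine

/-- `E ⊆ ℝⁿ` is an `(α,β)`-Furstenberg set: there is a set `L` of lines of positive `β`-dimensional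
Hausdorff (outer) measure in `A(n,1)`, each of which meets `E` in a set of positive `α`-dimensional
Hausdorff (outer) measure. No measurability of `E` or `L` is required. -/
def IsFurstenbergSet {n : ℕ} (α β : ℝ) (E : Set (EuclideanSpace ℝ (Fin n))) : Prop :=
  ∃ L : Set (AffineLine n), 0 < μH[β] L ∧ ∀ ω ∈ L, 0 < μH[α] (E ∩ ω.points)

end Furstenberg

/-! Lowering `β` to `min β α` keeps `L` of positive measure, so assume `β ≤ α`. The core is an `L²`
count at scale `δ = 2⁻ᵏ`. Put a Frostman probability measure `μ` of exponent `β` on the lines and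
one, `ν_ℓ`, of exponent `α` on each `E ∩ ℓ`. If `N` pieces of diameter at most `δ` cover these
supports, Cauchy–Schwarz gives `1 ≤ N ∑ μ(ℓ) μ(ℓ') ∑ᵢ ν_ℓ(i) ν_ℓ'(i)`. When `ℓ` and `ℓ'` are about
`2⁻ʲ` apart, the part of `ℓ` lying `δ`-close to `ℓ'` has length `O(δ 2ʲ)`, so the inner sum is
`O(δ^α (δ 2ʲ)^α)`, while such `ℓ'` have mass `O(2^(-jβ))`. As `β ≤ α`, the product is `O(δ^(α+β))`
for every `j ≤ k`, hence `N (k+1) δ^(α+β)` is bounded below (`one_le_card_mul_of_pairs`,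
`one_le_card_mul_of_content`).

If `μH[s] E = 0` with `s < α + β`, a dyadic cover of `E` has at most `2^(ks)` sets of scale `k`. Two
pigeonholings find one scale `k` that captures a polynomial-in-`k` share of the content of many
lines and of the line family itself; the exponential gain `2^(-k(α+β-s))` then contradicts the
count. Hausdorff content serves throughout because countable subadditivity suffices, so no
measurability is needed. -/

namespace Furstenberg

open scoped ENNReal NNReal

/-! ### Hausdorff content and dyadic covers -/

section HausdorffContent

/-- The `d`-dimensional Hausdorff content, as an outer measure. -/
noncomputable def hausdorffContent (X : Type*) [PseudoEMetricSpace X] (d : ℝ) : OuterMeasure X :=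
  OuterMeasure.boundedBy fun s => Metric.ediam s ^ d

theorem hausdorffContent_le_ediam_rpow {X : Type*} [PseudoEMetricSpace X] (d : ℝ) (s : Set X) :
    hausdorffContent X d s ≤ Metric.ediam s ^ d :=
  OuterMeasure.boundedBy_le s

/-- A cover of cost at most `r ^ d` consists of sets of diameter at most `r`, so covers witnessing
zero content are admissible in the definition of the measure at every scale `r`. -/
theorem hausdorffContent_pos {X : Type*} [EMetricSpace X] [MeasurableSpace X] [BorelSpace X]
    {d : ℝ} (hd : 0 < d) {s : Set X} (hs : 0 < μH[d] s) : 0 < hausdorffContent X d s := by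
  rw [pos_iff_ne_zero]
  intro h0
  refine hs.ne' ?_
  rw [Measure.hausdorffMeasure_apply]
  simp only [ENNReal.iSup_eq_zero]
  intro r hr
  refine le_antisymm (le_of_forall_pos_le_add fun ε hε => ?_) zero_le
  rw [zero_add]
  set η := min ε (r ^ d) with hη
  have hη0 : 0 < η := lt_min hε (ENNReal.rpow_pos_of_nonneg hr hd.le)
  rw [hausdorffContent, OuterMeasure.boundedBy_apply] at h0
  have hlt : (⨅ (t : ℕ → Set X) (_ : s ⊆ Set.iUnion t),
      ∑' n, ⨆ _ : (t n).Nonempty, Metric.ediam (t n) ^ d) < η := by rw [h0]; exact hη0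
  simp only [iInf_lt_iff] at hlt
  obtain ⟨t, ht, hsum⟩ := hlt
  have hdiam : ∀ i, Metric.ediam (t i) ≤ r := by
    intro i
    rcases (t i).eq_empty_or_nonempty with h | h
    · simp [h]
    · have h1 : Metric.ediam (t i) ^ d ≤ r ^ d := by
        calc Metric.ediam (t i) ^ d = ⨆ _ : (t i).Nonempty, Metric.ediam (t i) ^ d := by simp [h]
          _ ≤ ∑' n, ⨆ _ : (t n).Nonempty, Metric.ediam (t n) ^ d :=
            ENNReal.le_tsum (f := fun n => ⨆ _ : (t n).Nonempty, Metric.ediam (t n) ^ d) i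
          _ ≤ η := hsum.le
          _ ≤ r ^ d := min_le_right _ _
      exact (ENNReal.rpow_le_rpow_iff hd).1 h1
  exact iInf_le_of_le t (iInf_le_of_le ht (iInf_le_of_le hdiam (hsum.le.trans (min_le_left _ _))))

/-- Rounding the diameter up to a power of `1/2` at most doubles it. The extra `η` pays for sets of
diameter zero, which have no comparable dyadic scale. -/
theorem exists_half_pow_near {X : Type*} [PseudoEMetricSpace X] {s : ℝ} (hs : 0 < s)
    {A : Set X} (hA : Metric.ediam A ≤ 1) {η : ℝ≥0∞} (hη : 0 < η) :
    ∃ k : ℕ, Metric.ediam A ≤ ENNReal.ofReal ((1 / 2) ^ k) ∧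
      ENNReal.ofReal (((1 / 2 : ℝ) ^ k) ^ s) ≤
        ENNReal.ofReal (2 ^ s) * (⨆ _ : A.Nonempty, Metric.ediam A ^ s) + η := by
  rcases eq_or_ne (Metric.ediam A) 0 with h0 | h0
  · have hlim : Filter.Tendsto (fun k : ℕ => ENNReal.ofReal (((1 / 2 : ℝ) ^ k) ^ s)) Filter.atTop
        (nhds 0) := by
      have h1 : Filter.Tendsto (fun k : ℕ => ((1 / 2 : ℝ) ^ k) ^ s) Filter.atTop (nhds (0 ^ s)) :=
        (tendsto_pow_atTop_nhds_zero_of_lt_one (by norm_num) (by norm_num)).rpow_const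
          (Or.inr hs.le)
      rw [Real.zero_rpow hs.ne'] at h1
      simpa using ENNReal.tendsto_ofReal h1
    obtain ⟨k, hk⟩ := (hlim.eventually (gt_mem_nhds hη)).exists
    exact ⟨k, by simp [h0], hk.le.trans le_add_self⟩
  · have hne : A.Nonempty := by
      by_contra h
      rw [Set.not_nonempty_iff_eq_empty] at h
      simp [h] at h0
    have htop : Metric.ediam A ≠ ∞ := ne_top_of_le_ne_top ENNReal.one_ne_top hA
    set y := (Metric.ediam A).toReal with hy
    have hyA : Metric.ediam A = ENNReal.ofReal y := (ENNReal.ofReal_toReal htop).symm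
    have hy0 : 0 < y := ENNReal.toReal_pos h0 htop
    have hy1 : y ≤ 1 := by
      have := ENNReal.toReal_mono ENNReal.one_ne_top hA
      simpa using this
    obtain ⟨k, hk1, hk2⟩ := exists_nat_pow_near_of_lt_one hy0 hy1
      (show (0 : ℝ) < 1 / 2 by norm_num) (by norm_num)
    refine ⟨k, hyA ▸ ENNReal.ofReal_le_ofReal hk2, le_add_right ?_⟩
    rw [iSup_pos hne, hyA, ENNReal.ofReal_rpow_of_pos hy0, ← ENNReal.ofReal_mul (by positivity),
      ← Real.mul_rpow (by norm_num) hy0.le]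
    refine ENNReal.ofReal_le_ofReal (Real.rpow_le_rpow (by positivity) ?_ hs.le)
    rw [pow_succ] at hk1
    linarith

/-- A set of Hausdorff measure zero has arbitrarily economical dyadic covers. -/
theorem exists_dyadic_cover {X : Type*} [EMetricSpace X] [MeasurableSpace X] [BorelSpace X]
    {s : ℝ} (hs : 0 < s) {E : Set X} (hE : μH[s] E = 0) {ε : ℝ≥0∞} (hε : 0 < ε) :
    ∃ (t : ℕ → Set X) (k : ℕ → ℕ), E ⊆ ⋃ i, t i ∧
      (∀ i, Metric.ediam (t i) ≤ ENNReal.ofReal ((1 / 2) ^ k i)) ∧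
      ∑' i, ENNReal.ofReal (((1 / 2 : ℝ) ^ k i) ^ s) ≤ ε := by
  obtain ⟨η, hη, hηs⟩ := ENNReal.exists_pos_sum_of_countable (ENNReal.half_pos hε.ne').ne' ℕ
  have h2 : (0 : ℝ≥0∞) < ENNReal.ofReal (2 ^ s) := ENNReal.ofReal_pos.2 (by positivity)
  set ε' := ε / 2 / ENNReal.ofReal (2 ^ s) with hε'
  have hε'0 : 0 < ε' := ENNReal.div_pos (ENNReal.half_pos hε.ne').ne' ENNReal.ofReal_ne_top
  rw [Measure.hausdorffMeasure_apply] at hE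
  simp only [ENNReal.iSup_eq_zero] at hE
  have hlt := (hE 1 one_pos).trans_lt hε'0
  simp only [iInf_lt_iff] at hlt
  obtain ⟨t, ht, hdiam, hsum⟩ := hlt
  choose k hk1 hk2 using fun i => exists_half_pow_near hs (hdiam i)
    (ENNReal.coe_pos.2 (hη i))
  refine ⟨t, k, ht, hk1, ?_⟩
  calc ∑' i, ENNReal.ofReal (((1 / 2 : ℝ) ^ k i) ^ s)
      ≤ ∑' i, (ENNReal.ofReal (2 ^ s) * (⨆ _ : (t i).Nonempty, Metric.ediam (t i) ^ s) + η i) :=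
        ENNReal.tsum_le_tsum hk2
    _ = ENNReal.ofReal (2 ^ s) * (∑' i, ⨆ _ : (t i).Nonempty, Metric.ediam (t i) ^ s)
        + ∑' i, (η i : ℝ≥0∞) := by rw [ENNReal.tsum_add, ENNReal.tsum_mul_left]
    _ ≤ ε / 2 + ε / 2 := by
        refine add_le_add ?_ hηs.le
        calc _ ≤ ENNReal.ofReal (2 ^ s) * ε' := by gcongr
          _ ≤ ε / 2 := ENNReal.mul_div_le
    _ = ε := ENNReal.add_halves ε

end HausdorffContent

/-! ### Discrete Frostman measures -/

section Frostman

/-- Discrete Frostman lemma for a sequence of successively refined partitions, the cells of which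
are the fibres of the maps `q j`. -/
theorem exists_weights_of_partitions {X I : Type*} (H : OuterMeasure X) (q : ℕ → X → I)
    (hq : ∀ j x y, q (j + 1) x = q (j + 1) y → q j x = q j y)
    (hfin : ∀ j (A : Set X), (∀ x ∈ A, ∀ y ∈ A, q j x = q j y) → (q (j + 1) '' A).Finite)
    (b : ℕ → ℝ≥0) (k : ℕ) : ∀ (m j : ℕ), j + m = k → ∀ A : Set X,
    (∀ x ∈ A, ∀ y ∈ A, q j x = q j y) →
    (∀ i ≤ k, ∀ B ⊆ A, (∀ x ∈ B, ∀ y ∈ B, q i x = q i y) → H B ≤ b i) →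
    ∃ (S : Finset X) (w : X → ℝ≥0), (S : Set X) ⊆ A ∧ ((∑ x ∈ S, w x : ℝ≥0) : ℝ≥0∞) = H A ∧
      ∀ i, j ≤ i → i ≤ k → ∀ S' ⊆ S, (∀ x ∈ S', ∀ y ∈ S', q i x = q i y) →
        ∑ x ∈ S', w x ≤ b i := by
  classical
  intro m
  induction m with
  | zero =>
    intro j hj A hA hH
    rcases A.eq_empty_or_nonempty with rfl | ⟨x, hx⟩
    · exact ⟨∅, 0, by simp, by simp, fun i _ _ S' hS' _ => by
        rw [Finset.subset_empty.1 hS']; simp⟩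
    · have hAb : H A ≤ b j := hH j (by omega) A subset_rfl hA
      have hAt : H A ≠ ∞ := ne_top_of_le_ne_top ENNReal.coe_ne_top hAb
      -- In a cell of the finest level all the mass sits at a single point.
      refine ⟨{x}, fun _ => (H A).toNNReal, by simpa using hx, by simp [hAt], ?_⟩
      intro i h1 h2 S' hS' _
      obtain rfl : i = j := by omega
      calc ∑ x ∈ S', (H A).toNNReal ≤ ∑ x ∈ {x}, (H A).toNNReal := Finset.sum_le_sum_of_subset hS'
        _ ≤ b i := by
          rw [Finset.sum_singleton]
          exact ENNReal.coe_le_coe.1 ((ENNReal.coe_toNNReal hAt).le.trans hAb)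
  | succ m ih =>
    intro j hj A hA hH
    have hAb : H A ≤ b j := hH j (by omega) A subset_rfl hA
    have hAt : H A ≠ ∞ := ne_top_of_le_ne_top ENNReal.coe_ne_top hAb
    set F := (hfin j A hA).toFinset with hF
    have hch : ∀ a : I, ∃ (S : Finset X) (w : X → ℝ≥0), (S : Set X) ⊆ A ∩ {x | q (j + 1) x = a} ∧
        ((∑ x ∈ S, w x : ℝ≥0) : ℝ≥0∞) = H (A ∩ {x | q (j + 1) x = a}) ∧
        ∀ i, j + 1 ≤ i → i ≤ k → ∀ S' ⊆ S, (∀ x ∈ S', ∀ y ∈ S', q i x = q i y) →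
        ∑ x ∈ S', w x ≤ b i := by
      intro a
      refine ih (j + 1) (by omega) _ ?_ ?_
      · rintro x ⟨_, hx⟩ y ⟨_, hy⟩
        exact hx.trans hy.symm
      · intro i hi B hB
        exact hH i hi B (hB.trans Set.inter_subset_left)
    choose S w hS hsum hw using hch
    have hSq : ∀ a, ∀ x ∈ S a, q (j + 1) x = a := fun a x hx => (hS a hx).2
    set T : ℝ≥0 := ∑ a ∈ F, ∑ x ∈ S a, w a x with hT
    have hHT : H A ≤ T := by
      have hcov : A ⊆ ⋃ a ∈ F, A ∩ {x | q (j + 1) x = a} := by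
        intro x hx
        simp only [Set.mem_iUnion]
        exact ⟨q (j + 1) x, by simpa [hF] using ⟨x, hx, rfl⟩, hx, rfl⟩
      calc H A ≤ H (⋃ a ∈ F, A ∩ {x | q (j + 1) x = a}) := measure_mono hcov
        _ ≤ ∑ a ∈ F, H (A ∩ {x | q (j + 1) x = a}) := measure_biUnion_finset_le F _
        _ = T := by simp_rw [← hsum, hT]; push_cast; rfl
    -- By subadditivity the weights built on the children have total `T ≥ H A`. Scaling them by `r ≤
    -- 1` makes the total exactly `H A ≤ b j` and preserves the bounds on finer cells. If `T = 0`,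
    -- then `H A = 0` and `r = 0` serves.
    set r : ℝ≥0 := (H A).toNNReal / T with hr
    have hr1 : r ≤ 1 := div_le_one_of_le₀
      (ENNReal.coe_le_coe.1 ((ENNReal.coe_toNNReal hAt).le.trans hHT)) zero_le
    have hrT : r * T = (H A).toNNReal := by
      rcases eq_or_ne T 0 with h | h
      · have : H A = 0 := by simpa [h] using hHT
        simp [h, this]
      · exact div_mul_cancel₀ _ h
    have htot : ∑ x ∈ F.biUnion S, r * w (q (j + 1) x) x = (H A).toNNReal := by
      rw [Finset.sum_biUnion, ← hrT, hT, Finset.mul_sum]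
      · refine Finset.sum_congr rfl fun a _ => ?_
        rw [Finset.mul_sum]
        exact Finset.sum_congr rfl fun x hx => by rw [hSq a x hx]
      · intro a _ a' _ haa
        rw [Function.onFun, Finset.disjoint_left]
        intro x hx hx'
        exact haa ((hSq a x hx).symm.trans (hSq a' x hx'))
    refine ⟨F.biUnion S, fun x => r * w (q (j + 1) x) x, ?_, ?_, ?_⟩
    · intro x hx
      simp only [Finset.coe_biUnion, Set.mem_iUnion] at hx
      obtain ⟨a, _, hx⟩ := hx
      exact (hS a hx).1
    · rw [htot, ENNReal.coe_toNNReal hAt]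
    · intro i hi hik S' hS' hcell
      rcases hi.eq_or_lt with rfl | hlt
      · calc _ ≤ ∑ x ∈ F.biUnion S, r * w (q (j + 1) x) x := Finset.sum_le_sum_of_subset hS'
          _ ≤ b j := by
            rw [htot]
            exact ENNReal.coe_le_coe.1 ((ENNReal.coe_toNNReal hAt).le.trans hAb)
      · rcases S'.eq_empty_or_nonempty with rfl | ⟨x₀, hx₀⟩
        · simp
        -- Nesting puts a cell of level at least `j + 1` inside a single child, where the inductive
        -- bound applies.
        have hdesc : ∀ i, j + 1 ≤ i → ∀ x y, q i x = q i y → q (j + 1) x = q (j + 1) y := by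
          intro i hi
          induction i, hi using Nat.le_induction with
          | base => exact fun x y h => h
          | succ i _ ihi => exact fun x y h => ihi x y (hq i x y h)
        set a := q (j + 1) x₀ with ha
        have hS'a : ∀ x ∈ S', q (j + 1) x = a := fun x hx =>
          hdesc i hlt x x₀ (hcell x hx x₀ hx₀)
        have hsub : S' ⊆ S a := by
          intro x hx
          obtain ⟨a', _, hxa'⟩ := Finset.mem_biUnion.1 (hS' hx)
          rw [← hS'a x hx, hSq a' x hxa']
          exact hxa'
        calc ∑ x ∈ S', r * w (q (j + 1) x) x ≤ ∑ x ∈ S', w a x := by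
              refine Finset.sum_le_sum fun x hx => ?_
              rw [hS'a x hx]
              exact mul_le_of_le_one_left zero_le hr1
          _ ≤ b i := hw a i hlt hik S' hsub hcell

/-- Gives both the nesting of dyadic cells and the finiteness of the children: two choices per
coordinate. -/
theorem floor_two_pow_succ (j : ℕ) (x : ℝ) : ⌊2 ^ j * x⌋ = ⌊2 ^ (j + 1) * x⌋ / 2 := by
  have h : (2 : ℝ) ^ j * x = (2 ^ (j + 1) * x) / (2 : ℕ) := by
    push_cast
    ring
  rw [h, Int.floor_div_natCast]
  rfl

/-- Discrete Frostman lemma in coordinates: a set of content at least `c` carries a finitely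
supported probability measure with the Frostman condition at the scales `2⁻ʲ`, `j ≤ k`. -/
theorem exists_frostman_weights {X ι : Type*} [PseudoMetricSpace X] [Fintype ι] (Φ : X → ι → ℝ)
    (A : Set X) {D d c : ℝ} (hD : 0 ≤ D) (hd : 0 ≤ d)
    (hΦ : ∀ x ∈ A, ∀ y ∈ A, ∀ r, 0 ≤ r → (∀ i, |Φ x i - Φ y i| ≤ r) → dist x y ≤ D * r)
    (hcell : ∀ x ∈ A, ∀ y ∈ A, ∀ i, ⌊Φ x i⌋ = ⌊Φ y i⌋) (hc : 0 < c)
    (hcA : ENNReal.ofReal c ≤ hausdorffContent X d A) (k : ℕ) :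
    ∃ (S : Finset X) (w : X → ℝ), (S : Set X) ⊆ A ∧ (∀ x, 0 ≤ w x) ∧ ∑ x ∈ S, w x = 1 ∧
      ∀ j ≤ k, ∀ M : ℕ, ∀ S' ⊆ S,
        (∀ x ∈ S', ∀ y ∈ S', ∀ i, |Φ x i - Φ y i| ≤ M * (1 / 2) ^ j) →
        ∑ x ∈ S', w x ≤ (2 * M + 1) ^ Fintype.card ι * (D ^ d / c * ((1 / 2) ^ j) ^ d) := by
  classical
  set q : ℕ → X → ι → ℤ := fun j x i => ⌊2 ^ j * Φ x i⌋ with hqdef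
  set b : ℕ → ℝ≥0 := fun j => ((D * (1 / 2) ^ j) ^ d).toNNReal with hb
  have hbr : ∀ j, (b j : ℝ) = D ^ d * ((1 / 2) ^ j) ^ d := by
    intro j
    rw [hb, Real.coe_toNNReal _ (by positivity), Real.mul_rpow hD (by positivity)]
  have hH : ∀ i ≤ k, ∀ B ⊆ A, (∀ x ∈ B, ∀ y ∈ B, q i x = q i y) →
      hausdorffContent X d B ≤ b i := by
    intro i _ B hB hBq
    have hdiam : Metric.ediam B ≤ ENNReal.ofReal (D * (1 / 2) ^ i) := by
      refine Metric.ediam_le fun x hx y hy => ?_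
      rw [edist_dist]
      refine ENNReal.ofReal_le_ofReal (hΦ x (hB hx) y (hB hy) _ (by positivity) fun l => ?_)
      have h1 := Int.abs_sub_lt_one_of_floor_eq_floor (congrFun (hBq x hx y hy) l)
      rw [← mul_sub, abs_mul, abs_of_pos (by positivity : (0 : ℝ) < 2 ^ i)] at h1
      rw [one_div, inv_pow, ← one_div, le_div_iff₀ (by positivity), mul_comm]
      exact h1.le
    calc hausdorffContent X d B ≤ Metric.ediam B ^ d := hausdorffContent_le_ediam_rpow d B
      _ ≤ ENNReal.ofReal (D * (1 / 2) ^ i) ^ d := ENNReal.rpow_le_rpow hdiam hd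
      _ = b i := by rw [ENNReal.ofReal_rpow_of_nonneg (by positivity) hd]; rfl
  obtain ⟨S, w, hSA, hsum, hw⟩ := exists_weights_of_partitions (hausdorffContent X d) q
    (by
      intro j x y h
      funext i
      have := congrFun h i
      simp only [hqdef] at this ⊢
      rw [floor_two_pow_succ, this, ← floor_two_pow_succ])
    (by
      intro j B hB
      rcases B.eq_empty_or_nonempty with rfl | ⟨x₀, hx₀⟩
      · simp
      refine (Set.Finite.pi' (t := fun i => Set.Icc (2 * q j x₀ i) (2 * q j x₀ i + 1))
        fun i => Set.finite_Icc _ _).subset ?_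
      rintro _ ⟨x, hx, rfl⟩ i
      have h := congrFun (hB x hx x₀ hx₀) i
      simp only [hqdef] at h ⊢
      rw [← h, floor_two_pow_succ]
      constructor <;> omega)
    b k k 0 (by simp) A
    (by
      intro x hx y hy
      funext i
      simpa [hqdef] using hcell x hx y hy i)
    hH
  have hsum1 : c ≤ ∑ x ∈ S, (w x : ℝ) := by
    rw [← hsum, ENNReal.ofReal_le_coe] at hcA
    exact_mod_cast hcA
  -- Normalising by the total mass `W ≥ c` costs the factor `1 / c` in the Frostman bound.
  set W := ∑ x ∈ S, (w x : ℝ) with hW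
  have hW0 : 0 < W := hc.trans_le hsum1
  refine ⟨S, fun x => w x / W, hSA, fun x => by positivity, ?_, ?_⟩
  · rw [← Finset.sum_div, div_self hW0.ne']
  intro j hj M S' hS' hclose
  rcases S'.eq_empty_or_nonempty with rfl | ⟨x₀, hx₀⟩
  · rw [Finset.sum_empty]
    positivity
  -- A set of coordinate width at most `M 2⁻ʲ` meets only cells whose indices differ by at most `M`
  -- from that of `x₀`.
  set G : Finset (ι → ℤ) := Fintype.piFinset fun i => Finset.Icc (q j x₀ i - M) (q j x₀ i + M)
    with hG
  have hcard : G.card = (2 * M + 1) ^ Fintype.card ι := by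
    have h1 : ∀ i, (Finset.Icc (q j x₀ i - (M : ℤ)) (q j x₀ i + M)).card = 2 * M + 1 := by
      intro i
      rw [Int.card_Icc]
      omega
    rw [hG, Fintype.card_piFinset]
    simp only [h1, Finset.prod_const, Finset.card_univ]
  have hmaps : ∀ x ∈ S', q j x ∈ G := by
    intro x hx
    rw [hG, Fintype.mem_piFinset]
    intro i
    have h1 := hclose x hx x₀ hx₀ i
    have h2 : |2 ^ j * Φ x i - 2 ^ j * Φ x₀ i| ≤ M := by
      rw [← mul_sub, abs_mul, abs_of_pos (by positivity : (0 : ℝ) < 2 ^ j)]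
      calc (2 : ℝ) ^ j * |Φ x i - Φ x₀ i| ≤ 2 ^ j * (M * (1 / 2) ^ j) := by gcongr
        _ = M := by rw [one_div, inv_pow]; field_simp
    rw [abs_le] at h2
    rw [Finset.mem_Icc]
    constructor
    · rw [hqdef, ← Int.floor_sub_natCast]
      exact Int.floor_le_floor (by linarith)
    · rw [hqdef, ← Int.floor_add_natCast]
      exact Int.floor_le_floor (by linarith)
  rw [← Finset.sum_fiberwise_of_maps_to hmaps]
  have hfib : ∀ a ∈ G, ∑ x ∈ S' with q j x = a, (w x / W : ℝ)
      ≤ D ^ d / c * ((1 / 2) ^ j) ^ d := by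
    intro a _
    have h1 : ∑ x ∈ S' with q j x = a, (w x : ℝ) ≤ D ^ d * ((1 / 2) ^ j) ^ d := by
      rw [← hbr]
      exact_mod_cast hw j (Nat.zero_le _) hj _ ((Finset.filter_subset _ _).trans hS') (by
        intro x hx y hy
        rw [(Finset.mem_filter.1 hx).2, (Finset.mem_filter.1 hy).2])
    rw [← Finset.sum_div]
    calc _ ≤ D ^ d * ((1 / 2) ^ j) ^ d / c :=
          div_le_div₀ (by positivity) h1 hc hsum1
      _ = _ := by ring
  calc _ ≤ ∑ a ∈ G, D ^ d / c * ((1 / 2) ^ j) ^ d := Finset.sum_le_sum hfib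
    _ = _ := by
      rw [Finset.sum_const, nsmul_eq_mul, hcard]
      push_cast
      rfl

end Frostman

/-! ### Geometry of two nearby lines -/

section TwoLines

variable {F : Type*} [NormedAddCommGroup F] [InnerProductSpace ℝ F]

/-- The right-hand norm squared is `a² - 2abc + b²` with `c ∈ [0, 1]`: at least `(a - b)²` if `ab ≥
0`, and at least `a² + b² ≥ (a - b)² / 2` otherwise. -/
theorem abs_sub_sq_le_of_unit {e e' : F} (he : ‖e‖ = 1) (he' : ‖e'‖ = 1)
    (hc : 0 ≤ inner ℝ e e') (a b : ℝ) : (a - b) ^ 2 ≤ 2 * ‖a • e - b • e'‖ ^ 2 := by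
  have hc1 : inner ℝ e e' ≤ 1 := by
    have := real_inner_le_norm e e'
    rwa [he, he', one_mul] at this
  have hexp : ‖a • e - b • e'‖ ^ 2 = a ^ 2 - 2 * (a * b * inner ℝ e e') + b ^ 2 := by
    rw [norm_sub_sq_real, norm_smul, norm_smul, he, he', inner_smul_left, inner_smul_right,
      mul_one, mul_one, Real.norm_eq_abs, Real.norm_eq_abs, sq_abs, sq_abs]
    simp only [conj_trivial]
    ring
  rw [hexp]
  rcases le_total 0 (a * b) with hab | hab
  · nlinarith [mul_le_mul_of_nonneg_left hc1 hab, sq_nonneg (a - b)]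
  · nlinarith [mul_nonneg (neg_nonneg.2 hab) hc, sq_nonneg (a + b)]

/-- Two lines that are `δ`-close to each other at two places a distance `r` apart are themselves
`O(δ / r)`-close. -/
theorem abs_sub_mul_norm_sub_le {e e' v v' : F} (he : ‖e‖ = 1) (he' : ‖e'‖ = 1)
    (hev' : inner ℝ e' v' = 0) (hev : inner ℝ e v = 0) (hc : 0 ≤ inner ℝ e e')
    {t₁ t₂ t₁' t₂' δ T V : ℝ} (h₁ : ‖(t₁ • e + v) - (t₁' • e' + v')‖ ≤ δ)
    (h₂ : ‖(t₂ • e + v) - (t₂' • e' + v')‖ ≤ δ) (hT₁ : |t₁| ≤ T) (hT₂ : |t₂| ≤ T)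
    (hV : ‖v‖ ≤ V) :
    |t₁ - t₂| * ‖e - e'‖ ≤ 5 * δ ∧ |t₁ - t₂| * ‖v - v'‖ ≤ (14 * T + 5 * V) * δ := by
  have hδ : 0 ≤ δ := (norm_nonneg _).trans h₁
  set a := t₁ - t₂ with ha
  set b := t₁' - t₂' with hb
  have hw : ‖a • e - b • e'‖ ≤ 2 * δ := by
    have : a • e - b • e' =
        ((t₁ • e + v) - (t₁' • e' + v')) - ((t₂ • e + v) - (t₂' • e' + v')) := by
      rw [ha, hb, sub_smul, sub_smul]
      abel
    rw [this]
    linarith [norm_sub_le ((t₁ • e + v) - (t₁' • e' + v')) ((t₂ • e + v) - (t₂' • e' + v'))]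
  have hab : |a - b| ≤ 3 * δ := by
    have h := abs_sub_sq_le_of_unit he he' hc a b
    have h' : ‖a • e - b • e'‖ ^ 2 ≤ (2 * δ) ^ 2 := pow_le_pow_left₀ (norm_nonneg _) hw 2
    refine abs_le_of_sq_le_sq (by nlinarith [sq_nonneg δ]) (by positivity)
  have hE : |a| * ‖e - e'‖ ≤ 5 * δ := by
    have h : a • (e - e') = (a • e - b • e') - (a - b) • e' := by
      module
    calc |a| * ‖e - e'‖ = ‖a • (e - e')‖ := by rw [norm_smul, Real.norm_eq_abs]
      _ ≤ ‖a • e - b • e'‖ + ‖(a - b) • e'‖ := by rw [h]; exact norm_sub_le _ _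
      _ = ‖a • e - b • e'‖ + |a - b| := by rw [norm_smul, he', mul_one, Real.norm_eq_abs]
      _ ≤ 5 * δ := by linarith
  refine ⟨hE, ?_⟩
  set x := (t₁ • e + v) - (t₁' • e' + v') with hx
  have hT0 : 0 ≤ T := (abs_nonneg _).trans hT₁
  have hV0 : 0 ≤ V := (norm_nonneg _).trans hV
  have ht : |t₁ - t₁'| ≤ δ + T * ‖e - e'‖ + V * ‖e - e'‖ := by
    have hee : inner ℝ e' e' = (1 : ℝ) := by rw [real_inner_self_eq_norm_sq, he', one_pow]
    -- Pair `x` with `e'`; since `v ⊥ e`, the term `⟨e', v⟩` equals `-⟨e - e', v⟩`, so the drift of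
    -- the parameters is controlled by `δ` and `‖e - e'‖`.
    have h : t₁ - t₁' = inner ℝ e' x - t₁ * inner ℝ e' (e - e') + inner ℝ (e - e') v := by
      rw [hx, inner_sub_right, inner_add_right, inner_add_right, inner_smul_right,
        inner_smul_right, hev', hee, inner_sub_right, hee, inner_sub_left, hev]
      ring
    have k1 : |inner ℝ e' x| ≤ δ := by
      have := abs_real_inner_le_norm e' x
      rw [he', one_mul] at this
      exact this.trans h₁
    have k2 : |t₁ * inner ℝ e' (e - e')| ≤ T * ‖e - e'‖ := by
      have := abs_real_inner_le_norm e' (e - e')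
      rw [he', one_mul] at this
      rw [abs_mul]
      gcongr
    have k3 : |inner ℝ (e - e') v| ≤ V * ‖e - e'‖ := by
      have := abs_real_inner_le_norm (e - e') v
      rw [mul_comm] at this
      exact this.trans (by gcongr)
    rw [h]
    rw [abs_le] at k1 k2 k3 ⊢
    constructor <;> linarith [k1.1, k1.2, k2.1, k2.2, k3.1, k3.2]
  have hv : ‖v - v'‖ ≤ 2 * δ + (2 * T + V) * ‖e - e'‖ := by
    have h : v - v' = x - t₁ • (e - e') - (t₁ - t₁') • e' := by
      rw [hx, smul_sub, sub_smul]
      abel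
    calc ‖v - v'‖ ≤ ‖x - t₁ • (e - e')‖ + ‖(t₁ - t₁') • e'‖ := by rw [h]; exact norm_sub_le _ _
      _ ≤ ‖x‖ + ‖t₁ • (e - e')‖ + ‖(t₁ - t₁') • e'‖ := by gcongr; exact norm_sub_le _ _
      _ = ‖x‖ + |t₁| * ‖e - e'‖ + |t₁ - t₁'| := by
        rw [norm_smul, norm_smul, he', mul_one, Real.norm_eq_abs, Real.norm_eq_abs]
      _ ≤ δ + T * ‖e - e'‖ + (δ + T * ‖e - e'‖ + V * ‖e - e'‖) := by gcongr
      _ = _ := by ring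
  have haT : |a| ≤ 2 * T := by
    rw [ha]
    linarith [abs_sub t₁ t₂]
  calc |a| * ‖v - v'‖ ≤ |a| * (2 * δ + (2 * T + V) * ‖e - e'‖) := by gcongr
    _ = |a| * (2 * δ) + (2 * T + V) * (|a| * ‖e - e'‖) := by ring
    _ ≤ (2 * T) * (2 * δ) + (2 * T + V) * (5 * δ) := by gcongr
    _ = _ := by ring

end TwoLines

/-! ### The `L²` counting argument -/

section Counting

/-- Only fibres met by both `P` and `P'` contribute; there the second factor is at most `a`, and the
first factors add up to at most `b`. -/
theorem sum_fiber_mul_fiber_le {Y J : Type*} [DecidableEq J] (P P' : Finset Y) (ν ν' : Y → ℝ)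
    (hν : ∀ x, 0 ≤ ν x) (f : Y → J) (I : Finset J) {a b : ℝ} (ha : 0 ≤ a)
    (hfib : ∀ i, ∑ x ∈ P' with f x = i, ν' x ≤ a)
    (hhit : ∑ x ∈ P with ∃ x' ∈ P', f x' = f x, ν x ≤ b) :
    ∑ i ∈ I, (∑ x ∈ P with f x = i, ν x) * (∑ x ∈ P' with f x = i, ν' x) ≤ a * b := by
  classical
  set Q := {x ∈ P | ∃ x' ∈ P', f x' = f x} with hQ
  have hterm : ∀ i ∈ I, (∑ x ∈ P with f x = i, ν x) * (∑ x ∈ P' with f x = i, ν' x) ≤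
      (∑ x ∈ Q with f x = i, ν x) * a := by
    intro i _
    by_cases h : ∃ x' ∈ P', f x' = i
    · have hPQ : ({x ∈ P | f x = i} : Finset Y) = {x ∈ Q | f x = i} := by
        ext x
        simp only [hQ, Finset.mem_filter]
        constructor
        · rintro ⟨h1, rfl⟩
          exact ⟨⟨h1, h⟩, rfl⟩
        · rintro ⟨⟨h1, _⟩, h2⟩
          exact ⟨h1, h2⟩
      rw [hPQ]
      exact mul_le_mul_of_nonneg_left (hfib i) (Finset.sum_nonneg fun x _ => hν x)
    · have hemp : ({x ∈ P' | f x = i} : Finset Y) = ∅ := by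
        rw [Finset.filter_eq_empty_iff]
        exact fun x hx hxi => h ⟨x, hx, hxi⟩
      rw [hemp, Finset.sum_empty, mul_zero]
      exact mul_nonneg (Finset.sum_nonneg fun x _ => hν x) ha
  calc _ ≤ ∑ i ∈ I, (∑ x ∈ Q with f x = i, ν x) * a := Finset.sum_le_sum hterm
    _ = (∑ i ∈ I, ∑ x ∈ Q with f x = i, ν x) * a := by rw [Finset.sum_mul]
    _ ≤ (∑ x ∈ Q, ν x) * a :=
      mul_le_mul_of_nonneg_right (Finset.sum_fiberwise_le_sum_of_sum_fiber_nonneg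
        fun i _ => Finset.sum_nonneg fun x _ => hν x) ha
    _ ≤ a * b := by rw [mul_comm]; gcongr

/-- The `L²` argument: if the measures `ν ℓ` of two typical lines have few common points, then the
supports of the `ν ℓ` cannot be covered by few pieces. -/
theorem one_le_card_mul_of_pairs {Λ Y J : Type*} [DecidableEq J] (S : Finset Λ) (μ : Λ → ℝ)
    (hμ : ∀ ℓ, 0 ≤ μ ℓ) (hμ1 : ∑ ℓ ∈ S, μ ℓ = 1) (P : Λ → Finset Y) (ν : Λ → Y → ℝ)
    (hν1 : ∀ ℓ ∈ S, ∑ x ∈ P ℓ, ν ℓ x = 1) (f : Y → J) (I : Finset J)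
    (hI : ∀ ℓ ∈ S, ∀ x ∈ P ℓ, f x ∈ I) (k : ℕ) (near : ℕ → Λ → Λ → Prop)
    [∀ j ℓ, DecidablePred (near j ℓ)] (c m : ℕ → ℝ) (hc : ∀ j, 0 ≤ c j) {G : ℝ}
    (hpair : ∀ ℓ ∈ S, ∀ ℓ' ∈ S, ∃ j ≤ k, near j ℓ ℓ' ∧
      ∑ i ∈ I, (∑ x ∈ P ℓ with f x = i, ν ℓ x) * (∑ x ∈ P ℓ' with f x = i, ν ℓ' x) ≤ c j)
    (hnear : ∀ ℓ ∈ S, ∀ j ≤ k, ∑ ℓ' ∈ S with near j ℓ ℓ', μ ℓ' ≤ m j)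
    (hcm : ∀ j ≤ k, c j * m j ≤ G) : 1 ≤ I.card * ((k + 1) * G) := by
  set g : Λ → J → ℝ := fun ℓ i => ∑ x ∈ P ℓ with f x = i, ν ℓ x with hg
  have h1 : ∑ i ∈ I, ∑ ℓ ∈ S, μ ℓ * g ℓ i = 1 := by
    rw [Finset.sum_comm, ← hμ1]
    refine Finset.sum_congr rfl fun ℓ hℓ => ?_
    rw [← Finset.mul_sum, Finset.sum_fiberwise_of_maps_to (hI ℓ hℓ), hν1 ℓ hℓ, mul_one]
  have hcs : (∑ i ∈ I, ∑ ℓ ∈ S, μ ℓ * g ℓ i) ^ 2 ≤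
      I.card * ∑ i ∈ I, (∑ ℓ ∈ S, μ ℓ * g ℓ i) ^ 2 := sq_sum_le_card_mul_sum_sq
  rw [h1, one_pow] at hcs
  refine hcs.trans (mul_le_mul_of_nonneg_left ?_ (Nat.cast_nonneg _))
  have hexp : ∑ i ∈ I, (∑ ℓ ∈ S, μ ℓ * g ℓ i) ^ 2 =
      ∑ ℓ ∈ S, μ ℓ * ∑ ℓ' ∈ S, μ ℓ' * ∑ i ∈ I, g ℓ i * g ℓ' i := by
    simp_rw [sq, Finset.sum_mul_sum, Finset.mul_sum]
    rw [Finset.sum_comm]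
    refine Finset.sum_congr rfl fun ℓ _ => ?_
    rw [Finset.sum_comm]
    exact Finset.sum_congr rfl fun ℓ' _ => Finset.sum_congr rfl fun i _ => by ring
  rw [hexp]
  have hinner : ∀ ℓ ∈ S, ∑ ℓ' ∈ S, μ ℓ' * ∑ i ∈ I, g ℓ i * g ℓ' i ≤ (k + 1) * G := by
    intro ℓ hℓ
    -- Each `ℓ'` is charged at one suitable scale `j`. It may be near `ℓ` at others too, but the
    -- surplus terms are nonnegative, and `k + 1` scales give the factor `k + 1`.
    have hb : ∀ ℓ' ∈ S, μ ℓ' * ∑ i ∈ I, g ℓ i * g ℓ' i ≤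
        ∑ j ∈ Finset.range (k + 1), if near j ℓ ℓ' then c j * μ ℓ' else 0 := by
      intro ℓ' hℓ'
      obtain ⟨j, hj, hn, hle⟩ := hpair ℓ hℓ ℓ' hℓ'
      calc _ ≤ μ ℓ' * c j := mul_le_mul_of_nonneg_left hle (hμ ℓ')
        _ = if near j ℓ ℓ' then c j * μ ℓ' else 0 := by rw [if_pos hn, mul_comm]
        _ ≤ _ := Finset.single_le_sum
          (f := fun j => if near j ℓ ℓ' then c j * μ ℓ' else 0)
          (fun j _ => by
            split_ifs
            · exact mul_nonneg (hc j) (hμ ℓ')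
            · exact le_rfl)
          (Finset.mem_range.2 (Nat.lt_succ_of_le hj))
    calc _ ≤ ∑ ℓ' ∈ S, ∑ j ∈ Finset.range (k + 1), (if near j ℓ ℓ' then c j * μ ℓ' else 0) :=
          Finset.sum_le_sum hb
      _ = ∑ j ∈ Finset.range (k + 1), c j * ∑ ℓ' ∈ S with near j ℓ ℓ', μ ℓ' := by
          rw [Finset.sum_comm]
          refine Finset.sum_congr rfl fun j _ => ?_
          rw [← Finset.sum_filter, Finset.mul_sum]
      _ ≤ ∑ j ∈ Finset.range (k + 1), G := by
          refine Finset.sum_le_sum fun j hj => ?_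
          have hj' : j ≤ k := Nat.lt_succ_iff.1 (Finset.mem_range.1 hj)
          exact (mul_le_mul_of_nonneg_left (hnear ℓ hℓ j hj') (hc j)).trans (hcm j hj')
      _ = (k + 1) * G := by rw [Finset.sum_const, Finset.card_range, nsmul_eq_mul]; push_cast; rfl
  calc _ ≤ ∑ ℓ ∈ S, μ ℓ * ((k + 1) * G) :=
        Finset.sum_le_sum fun ℓ hℓ => mul_le_mul_of_nonneg_left (hinner ℓ hℓ) (hμ ℓ)
    _ = (k + 1) * G := by rw [← Finset.sum_mul, hμ1, one_mul]

end Counting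

/-! ### Coordinates on the space of lines -/

section Coordinates

variable {n : ℕ}

/-- The scaling `n + 1 ≥ √n` absorbs the comparison of the sup and Euclidean norms, and stays
positive for `n = 0`. -/
theorem norm_le_of_abs_coord_le {x : EuclideanSpace ℝ (Fin n)} {r : ℝ} (hr : 0 ≤ r)
    (h : ∀ i, |((n : ℝ) + 1) * x i| ≤ r) : ‖x‖ ≤ r := by
  have hn : (0 : ℝ) < (n : ℝ) + 1 := by positivity
  have h1 : ∀ i, ‖x i‖ ^ 2 ≤ (r / (n + 1)) ^ 2 := by
    intro i
    refine pow_le_pow_left₀ (norm_nonneg _) ?_ 2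
    have := h i
    rw [abs_mul, abs_of_pos hn] at this
    rw [le_div_iff₀ hn, mul_comm]
    exact this
  refine abs_le_of_sq_le_sq' ?_ hr |>.2
  rw [EuclideanSpace.norm_sq_eq]
  calc ∑ i, ‖x i‖ ^ 2 ≤ ∑ _i : Fin n, (r / (n + 1)) ^ 2 := Finset.sum_le_sum fun i _ => h1 i
    _ = (n / (n + 1) ^ 2) * r ^ 2 := by
      rw [Finset.sum_const, Finset.card_univ, Fintype.card_fin, nsmul_eq_mul, div_pow]
      ring
    _ ≤ 1 * r ^ 2 := by
      gcongr
      rw [div_le_one (by positivity)]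
      nlinarith [(Nat.cast_nonneg n : (0 : ℝ) ≤ n)]
    _ = r ^ 2 := one_mul _

/-- Scaled coordinates of the line `⟨e⟩ + v`. -/
def lineCoord (e v : EuclideanSpace ℝ (Fin n)) : Fin n ⊕ Fin n → ℝ :=
  Sum.elim (fun i => ((n : ℝ) + 1) * e i) (fun i => ((n : ℝ) + 1) * v i)

theorem norm_sub_le_of_lineCoord {e v e' v' : EuclideanSpace ℝ (Fin n)} {r : ℝ} (hr : 0 ≤ r)
    (h : ∀ i, |lineCoord e v i - lineCoord e' v' i| ≤ r) : ‖e - e'‖ ≤ r ∧ ‖v - v'‖ ≤ r := by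
  constructor
  · refine norm_le_of_abs_coord_le hr fun i => ?_
    simpa [lineCoord, mul_sub] using h (Sum.inl i)
  · refine norm_le_of_abs_coord_le hr fun i => ?_
    simpa [lineCoord, mul_sub] using h (Sum.inr i)

theorem abs_lineCoord_sub_le {e v e' v' : EuclideanSpace ℝ (Fin n)} (i : Fin n ⊕ Fin n) :
    |lineCoord e v i - lineCoord e' v' i| ≤ ((n : ℝ) + 1) * (‖e - e'‖ + ‖v - v'‖) := by
  have hn : (0 : ℝ) < (n : ℝ) + 1 := by positivity
  rcases i with i | i
  · have h := PiLp.norm_apply_le (e - e') i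
    simp only [lineCoord, Sum.elim_inl]
    rw [← mul_sub, abs_mul, abs_of_pos hn]
    gcongr
    refine le_trans ?_ (le_add_of_nonneg_right (norm_nonneg _))
    simpa using h
  · have h := PiLp.norm_apply_le (v - v') i
    simp only [lineCoord, Sum.elim_inr]
    rw [← mul_sub, abs_mul, abs_of_pos hn]
    gcongr
    refine le_trans ?_ (le_add_of_nonneg_left (norm_nonneg _))
    simpa using h

/-- Settles the sign ambiguity of directions: lines in a common unit cell of `lineCoord` satisfy the
sign hypothesis of `abs_sub_mul_norm_sub_le`. -/
theorem inner_nonneg_of_norm_sub_le_one {e e' : EuclideanSpace ℝ (Fin n)} (he : ‖e‖ = 1)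
    (he' : ‖e'‖ = 1) (h : ‖e - e'‖ ≤ 1) : 0 ≤ inner ℝ e e' := by
  have h1 := norm_sub_sq_real e e'
  rw [he, he'] at h1
  nlinarith [norm_nonneg (e - e')]

theorem AffineLine.IsParam.eq_of_mem {ℓ : AffineLine n} {e v x : EuclideanSpace ℝ (Fin n)}
    (h : ℓ.IsParam e v) (hx : x ∈ ℓ.points) : x = (inner ℝ e x : ℝ) • e + v := by
  rw [h.points_eq] at hx
  obtain ⟨t, rfl⟩ := hx
  rw [inner_add_right, inner_smul_right, real_inner_self_eq_norm_sq, h.norm_eq, h.inner_eq]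
  simp

theorem AffineLine.dist_le_of_isParam {ℓ ℓ' : AffineLine n} {e v e' v' : EuclideanSpace ℝ (Fin n)}
    (h : ℓ.IsParam e v) (h' : ℓ'.IsParam e' v') : dist ℓ ℓ' ≤ ‖e - e'‖ + ‖v - v'‖ := by
  change AffineLine.lineDist ℓ ℓ' ≤ _
  rw [AffineLine.lineDist_eq h h']
  gcongr
  exact min_le_left _ _

end Coordinates

/-! ### The estimate at a single scale -/

section Discretised

variable {n : ℕ}

/-- The part of `G` on the line `ω` in the unit interval with number `m`, in the coordinate given by
the direction `e`. -/
def linePiece (G : Set (EuclideanSpace ℝ (Fin n))) (ω : AffineLine n)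
    (e : EuclideanSpace ℝ (Fin n)) (m : ℤ) : Set (EuclideanSpace ℝ (Fin n)) :=
  {x | x ∈ G ∧ x ∈ ω.points ∧ ⌊(inner ℝ e x : ℝ)⌋ = m}

/-- On the line `x ↦ ⟨e, x⟩` is an isometry, so the Frostman lemma applies with one coordinate and
`D = 1`. -/
theorem exists_frostman_weights_linePiece {G : Set (EuclideanSpace ℝ (Fin n))} {ω : AffineLine n}
    {e v : EuclideanSpace ℝ (Fin n)} (h : ω.IsParam e v) {m : ℤ} {α c : ℝ} (hα : 0 ≤ α)
    (hc : 0 < c)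
    (hcG : ENNReal.ofReal c ≤ hausdorffContent (EuclideanSpace ℝ (Fin n)) α (linePiece G ω e m))
    (k : ℕ) :
    ∃ (P : Finset (EuclideanSpace ℝ (Fin n))) (ν : EuclideanSpace ℝ (Fin n) → ℝ),
      (P : Set (EuclideanSpace ℝ (Fin n))) ⊆ linePiece G ω e m ∧ (∀ x, 0 ≤ ν x) ∧
      ∑ x ∈ P, ν x = 1 ∧ ∀ j ≤ k, ∀ M : ℕ, ∀ P' ⊆ P,
        (∀ x ∈ P', ∀ y ∈ P', |(inner ℝ e x : ℝ) - inner ℝ e y| ≤ M * (1 / 2) ^ j) →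
        ∑ x ∈ P', ν x ≤ (2 * M + 1) * (1 / c * ((1 / 2) ^ j) ^ α) := by
  obtain ⟨P, ν, hP, hν0, hν1, hν⟩ := exists_frostman_weights (ι := Unit)
    (fun x _ => (inner ℝ e x : ℝ)) (linePiece G ω e m) (D := 1) zero_le_one hα
    (by
      intro x hx y hy r _ hxy
      have h1 : x - y = ((inner ℝ e x : ℝ) - inner ℝ e y) • e := by
        conv_lhs => rw [h.eq_of_mem hx.2.1, h.eq_of_mem hy.2.1]
        module
      rw [dist_eq_norm, h1, norm_smul, h.norm_eq, mul_one, one_mul, Real.norm_eq_abs]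
      exact hxy ())
    (fun x hx y hy _ => hx.2.2.trans hy.2.2.symm) hc hcG k
  refine ⟨P, ν, hP, hν0, hν1, fun j hj M P' hP' hclose => ?_⟩
  have := hν j hj M P' hP' fun x hx y hy _ => hclose x hx y hy
  simpa using this

/-- Discretised Furstenberg set estimate at scale `2⁻ᵏ`. -/
theorem one_le_card_mul_of_content {α β : ℝ} (hα : 0 < α) (hβ : 0 < β) (hβα : β ≤ α)
    (e v : AffineLine n → EuclideanSpace ℝ (Fin n)) (hp : ∀ ℓ : AffineLine n, ℓ.IsParam (e ℓ) (v ℓ))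
    {A : Set (AffineLine n)} {m : ℤ} {V : ℝ}
    (hcell : ∀ ℓ ∈ A, ∀ ℓ' ∈ A, ∀ i,
      ⌊lineCoord (e ℓ) (v ℓ) i⌋ = ⌊lineCoord (e ℓ') (v ℓ') i⌋)
    (hV : ∀ ℓ ∈ A, ‖v ℓ‖ ≤ V) {M : ℕ} (hM1 : 1 ≤ M)
    (hM : 2 * ((n + 1) * (5 + (14 * (|(m : ℝ)| + 1) + 5 * V))) ≤ M)
    {c₁ c₂ : ℝ} (hc₁ : 0 < c₁) (hc₂ : 0 < c₂)
    (hA : ENNReal.ofReal c₂ ≤ hausdorffContent (AffineLine n) β A)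
    {G : Set (EuclideanSpace ℝ (Fin n))}
    (hG : ∀ ℓ ∈ A, ENNReal.ofReal c₁ ≤
      hausdorffContent (EuclideanSpace ℝ (Fin n)) α (linePiece G ℓ (e ℓ) m))
    {J : Type*} (f : EuclideanSpace ℝ (Fin n) → J) (I : Finset J) (hfI : ∀ x ∈ G, f x ∈ I) (k : ℕ)
    (hf : ∀ x ∈ G, ∀ y ∈ G, f x = f y → dist x y ≤ (1 / 2) ^ k) :
    1 ≤ I.card * ((k + 1) * (3 * (2 * M + 1) * 5 ^ (n + n) * 2 ^ β / (c₁ ^ 2 * c₂) *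
      ((1 / 2) ^ k) ^ (α + β))) := by
  classical
  have hclose : ∀ ℓ ∈ A, ∀ ℓ' ∈ A, ∀ i,
      |lineCoord (e ℓ) (v ℓ) i - lineCoord (e ℓ') (v ℓ') i| ≤ 1 := fun ℓ hℓ ℓ' hℓ' i =>
    (Int.abs_sub_lt_one_of_floor_eq_floor (hcell ℓ hℓ ℓ' hℓ' i)).le
  obtain ⟨S, μ, hSA, hμ0, hμ1, hμ⟩ := exists_frostman_weights
    (fun ℓ => lineCoord (e ℓ) (v ℓ)) A (D := 2) zero_le_two hβ.le
    (by
      intro ℓ _ ℓ' _ r hr h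
      obtain ⟨h1, h2⟩ := norm_sub_le_of_lineCoord hr h
      linarith [AffineLine.dist_le_of_isParam (hp ℓ) (hp ℓ')])
    hcell hc₂ hA k
  have hchoice : ∀ ℓ : AffineLine n, ∃ (P : Finset (EuclideanSpace ℝ (Fin n)))
      (ν : EuclideanSpace ℝ (Fin n) → ℝ), ℓ ∈ A →
      (P : Set (EuclideanSpace ℝ (Fin n))) ⊆ linePiece G ℓ (e ℓ) m ∧ (∀ x, 0 ≤ ν x) ∧
      ∑ x ∈ P, ν x = 1 ∧ ∀ j ≤ k, ∀ M : ℕ, ∀ P' ⊆ P,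
        (∀ x ∈ P', ∀ y ∈ P', |(inner ℝ (e ℓ) x : ℝ) - inner ℝ (e ℓ) y| ≤ M * (1 / 2) ^ j) →
        ∑ x ∈ P', ν x ≤ (2 * M + 1) * (1 / c₁ * ((1 / 2) ^ j) ^ α) := by
    intro ℓ
    by_cases hℓ : ℓ ∈ A
    · obtain ⟨P, ν, h⟩ := exists_frostman_weights_linePiece (hp ℓ) hα.le hc₁ (hG ℓ hℓ) k
      exact ⟨P, ν, fun _ => h⟩
    · exact ⟨∅, 0, fun h => absurd h hℓ⟩
  choose P ν hPν using hchoice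
  set near : ℕ → AffineLine n → AffineLine n → Prop := fun j ℓ ℓ' =>
    ∀ i, |lineCoord (e ℓ) (v ℓ) i - lineCoord (e ℓ') (v ℓ') i| ≤ (1 / 2) ^ j with hneardef
  -- First factor: the `ν ℓ'`-mass of one piece. Second factor: the `ν ℓ`-mass of the points that
  -- share a piece with `ℓ'`.
  set c : ℕ → ℝ := fun j => (3 * (1 / c₁ * ((1 / 2) ^ k) ^ α)) *
    ((2 * M + 1) * (1 / c₁ * ((1 / 2) ^ (k - j)) ^ α)) with hcdef
  refine one_le_card_mul_of_pairs S μ hμ0 hμ1 P ν (fun ℓ hℓ => (hPν ℓ (hSA hℓ)).2.2.1) f I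
    (fun ℓ hℓ x hx => hfI x ((hPν ℓ (hSA hℓ)).1 hx).1) k near c
    (fun j => 5 ^ (n + n) * (2 ^ β / c₂ * ((1 / 2) ^ j) ^ β)) (fun j => by positivity) ?_ ?_ ?_
  · intro ℓ hℓ ℓ' hℓ'
    obtain ⟨hP, hν0, hν1, hν⟩ := hPν ℓ (hSA hℓ)
    obtain ⟨hP', hν0', hν1', hν'⟩ := hPν ℓ' (hSA hℓ')
    -- At the finest scale of nearness, either `j = k` or some coordinates of the two lines differ
    -- by more than `2^(-(j+1))`.
    set j := Nat.findGreatest (fun j => near j ℓ ℓ') k with hj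
    have hjk : j ≤ k := Nat.findGreatest_le k
    have hnear0 : near 0 ℓ ℓ' := by
      intro i
      rw [pow_zero]
      exact hclose ℓ (hSA hℓ) ℓ' (hSA hℓ') i
    have hnearj : near j ℓ ℓ' :=
      Nat.findGreatest_spec (P := fun j => near j ℓ ℓ') (Nat.zero_le k) hnear0
    refine ⟨j, hjk, hnearj, ?_⟩
    refine sum_fiber_mul_fiber_le (P ℓ) (P ℓ') (ν ℓ) (ν ℓ') hν0 f I (by positivity) ?_ ?_
    · intro i
      have := hν' k le_rfl 1 {x ∈ P ℓ' | f x = i} (Finset.filter_subset _ _) (by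
        intro x hx y hy
        rw [Finset.mem_filter] at hx hy
        have h1 := hf x (hP' hx.1).1 y (hP' hy.1).1 (hx.2.trans hy.2.symm)
        have h2 := abs_real_inner_le_norm (e ℓ') (x - y)
        rw [(hp ℓ').norm_eq, one_mul, ← dist_eq_norm, inner_sub_right] at h2
        simpa using h2.trans h1)
      norm_num at this ⊢
      exact this
    · refine hν (k - j) (Nat.sub_le _ _) M _ (Finset.filter_subset _ _) ?_
      intro x hx y hy
      rw [Finset.mem_filter] at hx hy
      obtain ⟨hxP, x', hx'P, hxx⟩ := hx
      obtain ⟨hyP, y', hy'P, hyy⟩ := hy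
      have hx1 := hP hxP
      have hy1 := hP hyP
      have hx1' := hP' hx'P
      have hy1' := hP' hy'P
      rcases hjk.eq_or_lt with hjk' | hjk'
      -- For `j = k` no separation is available, but the bound needed is at unit scale and both
      -- points lie in the same unit interval.
      · rw [hjk', Nat.sub_self, pow_zero, mul_one]
        exact (Int.abs_sub_lt_one_of_floor_eq_floor (hx1.2.2.trans hy1.2.2.symm)).le.trans
          (by exact_mod_cast hM1)
      · have hnot : ¬ near (j + 1) ℓ ℓ' :=
          Nat.findGreatest_is_greatest (P := fun j => near j ℓ ℓ') (Nat.lt_succ_self j) hjk'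
        simp only [hneardef, not_forall, not_le] at hnot
        obtain ⟨i, hi⟩ := hnot
        have habs : ∀ t : ℝ, ⌊t⌋ = m → |t| ≤ |(m : ℝ)| + 1 := by
          intro t ht
          have h1 := Int.floor_le t
          have h2 := Int.lt_floor_add_one t
          rw [ht] at h1 h2
          rw [abs_le]
          constructor <;> linarith [neg_abs_le (m : ℝ), le_abs_self (m : ℝ)]
        have hgeo := abs_sub_mul_norm_sub_le (hp ℓ).norm_eq (hp ℓ').norm_eq (hp ℓ').inner_eq
          (hp ℓ).inner_eq
          (inner_nonneg_of_norm_sub_le_one (hp ℓ).norm_eq (hp ℓ').norm_eq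
            (norm_sub_le_of_lineCoord zero_le_one
              (hclose ℓ (hSA hℓ) ℓ' (hSA hℓ'))).1)
          (t₁ := inner ℝ (e ℓ) x) (t₂ := inner ℝ (e ℓ) y) (t₁' := inner ℝ (e ℓ') x')
          (t₂' := inner ℝ (e ℓ') y') (δ := (1 / 2) ^ k) (T := |(m : ℝ)| + 1) (V := V)
          (by
            rw [← (hp ℓ).eq_of_mem hx1.2.1, ← (hp ℓ').eq_of_mem hx1'.2.1, ← dist_eq_norm]
            exact hf x hx1.1 x' hx1'.1 hxx.symm)
          (by
            rw [← (hp ℓ).eq_of_mem hy1.2.1, ← (hp ℓ').eq_of_mem hy1'.2.1, ← dist_eq_norm]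
            exact hf y hy1.1 y' hy1'.1 hyy.symm)
          (habs _ hx1.2.2) (habs _ hy1.2.2) (hV ℓ (hSA hℓ))
        set τ := |(inner ℝ (e ℓ) x : ℝ) - inner ℝ (e ℓ) y| with hτ
        set K := 5 + (14 * (|(m : ℝ)| + 1) + 5 * V) with hK
        -- Points of `ℓ` at parameter distance `τ`, both `2⁻ᵏ`-close to `ℓ'`, force the lines to be
        -- `O(2⁻ᵏ / τ)`-close; against the separation this gives `τ = O(2^(-(k-j)))`.
        have h1 : τ * (1 / 2) ^ (j + 1) ≤ (n + 1) * K * (1 / 2) ^ k := by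
          calc τ * (1 / 2) ^ (j + 1)
              ≤ τ * ((n + 1) * (‖e ℓ - e ℓ'‖ + ‖v ℓ - v ℓ'‖)) :=
                mul_le_mul_of_nonneg_left (hi.le.trans (abs_lineCoord_sub_le i)) (abs_nonneg _)
            _ = (n + 1) * (τ * ‖e ℓ - e ℓ'‖ + τ * ‖v ℓ - v ℓ'‖) := by ring
            _ ≤ (n + 1) * (5 * (1 / 2) ^ k +
                (14 * (|(m : ℝ)| + 1) + 5 * V) * (1 / 2) ^ k) := by
                exact mul_le_mul_of_nonneg_left (add_le_add hgeo.1 hgeo.2) (by positivity)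
            _ = _ := by rw [hK]; ring
        have h2 : ((1 : ℝ) / 2) ^ k = (1 / 2) ^ (k - j) * (1 / 2) ^ j := by
          rw [← pow_add, Nat.sub_add_cancel hjk]
        have hpos : (0 : ℝ) < (1 / 2) ^ j := by positivity
        rw [h2, pow_succ] at h1
        have h3 : τ * (1 / 2) ^ j ≤ 2 * ((n + 1) * K) * (1 / 2) ^ (k - j) * (1 / 2) ^ j := by
          linarith
        have h4 := le_of_mul_le_mul_right h3 hpos
        exact h4.trans (by gcongr)
  · intro ℓ hℓ j hj
    -- Two lines near `ℓ` differ by at most `2 · 2⁻ʲ` in each of the `n + n` coordinates, whence `5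
    -- ^ (n + n)`.
    have := hμ j hj 2 {ℓ' ∈ S | near j ℓ ℓ'} (Finset.filter_subset _ _) (by
      intro a ha b hb i
      rw [Finset.mem_filter] at ha hb
      have h1 := ha.2 i
      have h2 := hb.2 i
      rw [abs_le] at h1 h2 ⊢
      push_cast
      constructor <;> linarith [h1.1, h1.2, h2.1, h2.2])
    rw [Fintype.card_sum, Fintype.card_fin] at this
    norm_num at this ⊢
    exact this
  · intro j hj
    -- Here `β ≤ α` enters: with exponent `β` on both factors the dependence on `j` cancels.
    have hkj : ((1 / 2 : ℝ) ^ (k - j)) ^ α ≤ ((1 / 2 : ℝ) ^ (k - j)) ^ β :=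
      Real.rpow_le_rpow_of_exponent_ge (by positivity)
        (pow_le_one₀ (by norm_num) (by norm_num)) hβα
    have hsplit : ((1 / 2 : ℝ) ^ k) ^ (α + β) =
        ((1 / 2 : ℝ) ^ k) ^ α * (((1 / 2 : ℝ) ^ (k - j)) ^ β * ((1 / 2 : ℝ) ^ j) ^ β) := by
      rw [Real.rpow_add (by positivity), ← Real.mul_rpow (by positivity) (by positivity),
        ← pow_add, Nat.sub_add_cancel hj]
    calc c j * (5 ^ (n + n) * (2 ^ β / c₂ * ((1 / 2) ^ j) ^ β))
        ≤ ((3 * (1 / c₁ * ((1 / 2) ^ k) ^ α)) *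
          ((2 * M + 1) * (1 / c₁ * ((1 / 2) ^ (k - j)) ^ β))) *
          (5 ^ (n + n) * (2 ^ β / c₂ * ((1 / 2) ^ j) ^ β)) := by
          simp only [hcdef]
          gcongr
      _ = _ := by
          rw [hsplit]
          field_simp

end Discretised

/-! ### Pigeonholing over scales -/

section Pigeonhole

theorem exists_ofReal_inv_nat_le {x : ℝ≥0∞} (hx : 0 < x) :
    ∃ N : ℕ, ENNReal.ofReal (1 / ((N : ℝ) + 1)) ≤ x := by
  obtain ⟨r, hr0, hrx⟩ := ENNReal.lt_iff_exists_nnreal_btwn.1 hx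
  obtain ⟨N, hN⟩ := exists_nat_one_div_lt (NNReal.coe_pos.2 (ENNReal.coe_pos.1 hr0))
  refine ⟨N, le_trans ?_ hrx.le⟩
  rw [← ENNReal.ofReal_coe_nnreal]
  exact ENNReal.ofReal_le_ofReal hN.le

/-- Weights on the dyadic scales that decay only polynomially. -/
theorem exists_scale_weights : ∃ γ : ℝ, 0 < γ ∧
    ∑' k : ℕ, ENNReal.ofReal (γ / ((k : ℝ) + 1) ^ 2) < 1 := by
  have hsum : Summable fun k : ℕ => 1 / ((k : ℝ) + 1) ^ 2 := by
    have := (summable_nat_add_iff 1).2 (Real.summable_one_div_nat_pow.2 one_lt_two)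
    simpa using this
  set S := ∑' k : ℕ, 1 / ((k : ℝ) + 1) ^ 2 with hS
  have hS0 : 0 ≤ S := tsum_nonneg fun k => by positivity
  refine ⟨1 / (S + 1), by positivity, ?_⟩
  have h1 : ∀ k : ℕ, 1 / (S + 1) / ((k : ℝ) + 1) ^ 2 = 1 / (S + 1) * (1 / ((k : ℝ) + 1) ^ 2) :=
    fun k => by ring
  simp_rw [h1]
  rw [← ENNReal.ofReal_tsum_of_nonneg (fun k => by positivity) (hsum.mul_left _), tsum_mul_left,
    ← hS, ENNReal.ofReal_lt_one, one_div, inv_mul_lt_iff₀ (by positivity)]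
  linarith

/-- Otherwise countable subadditivity would give `H A < c`. The pieces need not be measurable. -/
theorem exists_ofReal_mul_le_of_subset_iUnion {X : Type*} (H : OuterMeasure X) {A : Set X}
    {B : ℕ → Set X} (hAB : A ⊆ ⋃ k, B k) {c : ℝ} (hc : 0 < c) (hcA : ENNReal.ofReal c ≤ H A)
    {p : ℕ → ℝ} (hp : ∑' k, ENNReal.ofReal (p k) < 1) :
    ∃ k, ENNReal.ofReal (c * p k) ≤ H (B k) := by
  by_contra! h
  have : ENNReal.ofReal c < ENNReal.ofReal c := by
    calc ENNReal.ofReal c ≤ H A := hcA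
      _ ≤ H (⋃ k, B k) := measure_mono hAB
      _ ≤ ∑' k, H (B k) := measure_iUnion_le B
      _ ≤ ∑' k, ENNReal.ofReal c * ENNReal.ofReal (p k) :=
        ENNReal.tsum_le_tsum fun k => by rw [← ENNReal.ofReal_mul hc.le]; exact (h k).le
      _ = ENNReal.ofReal c * ∑' k, ENNReal.ofReal (p k) := ENNReal.tsum_mul_left
      _ < ENNReal.ofReal c * 1 :=
        ENNReal.mul_lt_mul_right (ENNReal.ofReal_pos.2 hc).ne' ENNReal.ofReal_ne_top hp
      _ = ENNReal.ofReal c := mul_one _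
  exact lt_irrefl _ this

theorem exists_forall_ge_mul_pow_lt_one (K : ℝ) {r : ℝ} (hr0 : 0 < r) (hr1 : r < 1) (d : ℕ) :
    ∃ k₀ : ℕ, ∀ k ≥ k₀, K * ((k : ℝ) + 1) ^ d * r ^ k < 1 := by
  have h := tendsto_pow_const_mul_const_pow_of_abs_lt_one d
    (show |r| < 1 by rwa [abs_of_pos hr0])
  have h1 := ((Filter.tendsto_add_atTop_iff_nat 1).2 h).const_mul (K / r)
  rw [mul_zero] at h1
  obtain ⟨k₀, hk₀⟩ := Filter.eventually_atTop.1 (h1.eventually (gt_mem_nhds one_pos))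
  refine ⟨k₀, fun k hk => ?_⟩
  have h2 := hk₀ k hk
  push_cast at h2
  rw [pow_succ] at h2
  calc K * ((k : ℝ) + 1) ^ d * r ^ k = K / r * (((k : ℝ) + 1) ^ d * (r ^ k * r)) := by
        field_simp
    _ < 1 := h2

end Pigeonhole

/-! ### Uniform bounds on a subfamily of lines -/

section Localisation

variable {n : ℕ}

/-- A Furstenberg set has a localised family of lines with uniform lower bounds. -/
theorem exists_localised_family {α β : ℝ} (hα : 0 < α) (hβ : 0 < β)
    {E : Set (EuclideanSpace ℝ (Fin n))} (hE : IsFurstenbergSet α β E)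
    (e v : AffineLine n → EuclideanSpace ℝ (Fin n)) :
    ∃ (A : Set (AffineLine n)) (m : ℤ) (c₁ c₂ : ℝ), 0 < c₁ ∧ 0 < c₂ ∧
      (∀ ℓ ∈ A, ∀ ℓ' ∈ A, ∀ i,
        ⌊lineCoord (e ℓ) (v ℓ) i⌋ = ⌊lineCoord (e ℓ') (v ℓ') i⌋) ∧
      ENNReal.ofReal c₂ ≤ hausdorffContent (AffineLine n) β A ∧
      ∀ ℓ ∈ A, ENNReal.ofReal c₁ ≤
        hausdorffContent (EuclideanSpace ℝ (Fin n)) α (linePiece E ℓ (e ℓ) m) := by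
  obtain ⟨L, hL, hLE⟩ := hE
  -- Countably many labels: the unit cell of the line, the unit interval on it, and a lower bound `1
  -- / (N + 1)` for the content there. Some class therefore has positive measure.
  set B : (Fin n ⊕ Fin n → ℤ) × ℤ × ℕ → Set (AffineLine n) := fun z =>
    {ω | (∀ i, ⌊lineCoord (e ω) (v ω) i⌋ = z.1 i) ∧ ENNReal.ofReal (1 / ((z.2.2 : ℝ) + 1)) ≤
      hausdorffContent (EuclideanSpace ℝ (Fin n)) α (linePiece E ω (e ω) z.2.1)} with hB
  have hcov : L ⊆ ⋃ z, B z := by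
    intro ω hω
    have hun : E ∩ ω.points ⊆ ⋃ m : ℤ, linePiece E ω (e ω) m := fun x hx =>
      Set.mem_iUnion.2 ⟨_, hx.1, hx.2, rfl⟩
    have hpos := (hLE ω hω).trans_le (measure_mono hun)
    obtain ⟨m, hm⟩ := exists_measure_pos_of_not_measure_iUnion_null hpos.ne'
    obtain ⟨N, hN⟩ := exists_ofReal_inv_nat_le (hausdorffContent_pos hα hm)
    exact Set.mem_iUnion.2 ⟨(fun i => ⌊lineCoord (e ω) (v ω) i⌋, m, N), fun _ => rfl, hN⟩
  obtain ⟨z, hz⟩ := exists_measure_pos_of_not_measure_iUnion_null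
    (hL.trans_le (measure_mono hcov)).ne'
  obtain ⟨N, hN⟩ := exists_ofReal_inv_nat_le (hausdorffContent_pos hβ hz)
  exact ⟨B z, z.2.1, 1 / ((z.2.2 : ℝ) + 1), 1 / ((N : ℝ) + 1), by positivity, by positivity,
    fun ℓ hℓ ℓ' hℓ' i => (hℓ.1 i).trans (hℓ'.1 i).symm, hN, fun ℓ hℓ => hℓ.2⟩

end Localisation

/-! ### From the single-scale estimate to dimension -/

section Dimension

variable {n : ℕ}

theorem add_le_of_hausdorffMeasure_eq_zero {α β s : ℝ} (hα : 0 < α) (hβ : 0 < β) (hβα : β ≤ α)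
    {E : Set (EuclideanSpace ℝ (Fin n))} (hE : IsFurstenbergSet α β E) (hs : 0 < s)
    (hEs : μH[s] E = 0) : α + β ≤ s := by
  by_contra! hlt
  choose e v hp using fun ℓ : AffineLine n => ℓ.exists_isParam
  obtain ⟨A, m, c₁, c₂, hc₁, hc₂, hcell, hA, hAE⟩ := exists_localised_family hα hβ hE e v
  have content_nonempty : ∀ {X : Type} [PseudoEMetricSpace X] {d c : ℝ} {s : Set X}, 0 < c →
      ENNReal.ofReal c ≤ hausdorffContent X d s → s.Nonempty := by
    intro X _ d c s hc h
    by_contra hs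
    rw [Set.not_nonempty_iff_eq_empty] at hs
    rw [hs, measure_empty, nonpos_iff_eq_zero, ENNReal.ofReal_eq_zero] at h
    linarith
  obtain ⟨ω₀, hω₀⟩ := content_nonempty hc₂ hA
  have hV : ∀ ℓ ∈ A, ‖v ℓ‖ ≤ ‖v ω₀‖ + 1 := by
    intro ℓ hℓ
    have h := (norm_sub_le_of_lineCoord zero_le_one fun i =>
      (Int.abs_sub_lt_one_of_floor_eq_floor (hcell ℓ hℓ ω₀ hω₀ i)).le).2
    linarith [norm_le_norm_add_norm_sub' (v ℓ) (v ω₀)]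
  obtain ⟨M₀, hM₀⟩ :=
    exists_nat_ge (2 * (((n : ℝ) + 1) * (5 + (14 * (|(m : ℝ)| + 1) + 5 * (‖v ω₀‖ + 1)))))
  set M := M₀ + 1 with hM
  have hM' : 2 * (((n : ℝ) + 1) * (5 + (14 * (|(m : ℝ)| + 1) + 5 * (‖v ω₀‖ + 1)))) ≤ (M : ℝ) := by
    rw [hM]
    push_cast
    linarith
  obtain ⟨γ, hγ, hγsum⟩ := exists_scale_weights
  set p : ℕ → ℝ := fun k => γ / ((k : ℝ) + 1) ^ 2 with hpdef
  have hp0 : ∀ k, 0 < p k := fun k => by positivity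
  set K : ℝ := 3 * (2 * M + 1) * 5 ^ (n + n) * 2 ^ β with hK
  set r : ℝ := (1 / 2) ^ (α + β - s) with hr
  have hr0 : 0 < r := by positivity
  have hr1 : r < 1 := Real.rpow_lt_one (by norm_num) (by norm_num) (by linarith)
  -- The exponent 7: one power of `k + 1` from the `L²` argument, and six from `(c₁ * p k) ^ 2 * (c₂
  -- * p k)`.
  obtain ⟨k₀, hk₀⟩ := exists_forall_ge_mul_pow_lt_one (K / (c₁ ^ 2 * c₂ * γ ^ 3)) hr0 hr1 7
  -- A total cost of at most `2^(-k₀ s)` forces every scale in the cover to be at least `k₀`.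
  obtain ⟨t, κ, hcov, hdiam, hsum⟩ := exists_dyadic_cover hs hEs
    (ε := ENNReal.ofReal (((1 / 2 : ℝ) ^ k₀) ^ s)) (ENNReal.ofReal_pos.2 (by positivity))
  have hκ : ∀ i, k₀ ≤ κ i := by
    intro i
    have h1 := (ENNReal.le_tsum (f := fun i => ENNReal.ofReal (((1 / 2 : ℝ) ^ κ i) ^ s)) i).trans
      hsum
    rw [ENNReal.ofReal_le_ofReal_iff (by positivity),
      Real.rpow_le_rpow_iff (by positivity) (by positivity) hs] at h1
    exact (pow_le_pow_iff_right_of_lt_one₀ (by norm_num) (by norm_num)).1 h1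
  have hsum1 : ∑' i, ENNReal.ofReal (((1 / 2 : ℝ) ^ κ i) ^ s) ≤ 1 := by
    refine hsum.trans (ENNReal.ofReal_le_one.2 ?_)
    exact Real.rpow_le_one (by positivity) (pow_le_one₀ (by norm_num) (by norm_num)) hs.le
  set G : ℕ → Set (EuclideanSpace ℝ (Fin n)) := fun k => {x | x ∈ E ∧ ∃ i, κ i = k ∧ x ∈ t i}
    with hG
  have hscale : ∀ ℓ : AffineLine n, ∃ k, ℓ ∈ A → ENNReal.ofReal (c₁ * p k) ≤
      hausdorffContent (EuclideanSpace ℝ (Fin n)) α (linePiece (G k) ℓ (e ℓ) m) := by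
    intro ℓ
    by_cases hℓ : ℓ ∈ A
    · obtain ⟨k, hk⟩ := exists_ofReal_mul_le_of_subset_iUnion
        (hausdorffContent (EuclideanSpace ℝ (Fin n)) α)
        (B := fun k => linePiece (G k) ℓ (e ℓ) m) (by
          intro x hx
          obtain ⟨i, hi⟩ := Set.mem_iUnion.1 (hcov hx.1)
          exact Set.mem_iUnion.2 ⟨κ i, ⟨hx.1, i, rfl, hi⟩, hx.2⟩) hc₁ (hAE ℓ hℓ) hγsum
      exact ⟨k, fun _ => hk⟩
    · exact ⟨0, fun h => absurd h hℓ⟩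
  -- `σ ℓ` is a scale whose covering sets catch a fair share of `ℓ`; the next pigeonholing makes it
  -- constant on a large subfamily.
  choose σ hσ using hscale
  obtain ⟨k, hk⟩ := exists_ofReal_mul_le_of_subset_iUnion (hausdorffContent (AffineLine n) β)
    (B := fun k => {ℓ | ℓ ∈ A ∧ σ ℓ = k})
    (fun ℓ hℓ => Set.mem_iUnion.2 ⟨σ ℓ, hℓ, rfl⟩) hc₂ hA hγsum
  have hc₂k : 0 < c₂ * p k := mul_pos hc₂ (hp0 k)
  have hc₁k : 0 < c₁ * p k := mul_pos hc₁ (hp0 k)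
  -- Positive content yields a line and a point on it in `G k`, so the scale `k` really occurs in
  -- the cover.
  have hkk₀ : k₀ ≤ k := by
    obtain ⟨ℓ, hℓ, hℓk⟩ := content_nonempty hc₂k hk
    obtain ⟨x, hx⟩ := content_nonempty hc₁k (hℓk ▸ hσ ℓ hℓ)
    obtain ⟨_, i, hi, _⟩ := hx.1
    exact hi ▸ hκ i
  have hxs : 0 < ((1 / 2 : ℝ) ^ k) ^ s := by positivity
  -- Each set of scale `k` costs `2^(-ks)` and the total is at most one, so there are at most
  -- `2^(ks)` of them.
  obtain ⟨hfin, hcard⟩ := ENNReal.finset_card_const_le_le_of_tsum_le ENNReal.one_ne_top hsum1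
    (ENNReal.ofReal_pos.2 hxs).ne'
  set I := hfin.toFinset with hI
  have hcard' : (I.card : ℝ) ≤ 1 / ((1 / 2 : ℝ) ^ k) ^ s := by
    rw [ENNReal.le_div_iff_mul_le (Or.inl (ENNReal.ofReal_pos.2 hxs).ne')
      (Or.inl ENNReal.ofReal_ne_top), ← ENNReal.ofReal_natCast,
      ← ENNReal.ofReal_mul (Nat.cast_nonneg _), ENNReal.ofReal_le_one] at hcard
    rwa [le_div_iff₀ hxs]
  have hf : ∀ x, ∃ i, x ∈ G k → κ i = k ∧ x ∈ t i := by
    intro x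
    by_cases hx : x ∈ G k
    · obtain ⟨_, i, hi⟩ := hx
      exact ⟨i, fun _ => hi⟩
    · exact ⟨0, fun h => absurd h hx⟩
  choose f hf using hf
  have hmain := one_le_card_mul_of_content hα hβ hβα e v hp (A := {ℓ | ℓ ∈ A ∧ σ ℓ = k})
    (fun ℓ hℓ ℓ' hℓ' => hcell ℓ hℓ.1 ℓ' hℓ'.1) (fun ℓ hℓ => hV ℓ hℓ.1) (by omega : 1 ≤ M) hM'
    hc₁k hc₂k hk (G := G k) (fun ℓ hℓ => hℓ.2 ▸ hσ ℓ hℓ.1) f I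
    (fun x hx => by
      rw [hI, Set.Finite.mem_toFinset, Set.mem_ofPred_eq, (hf x hx).1]) k
    (fun x hx y hy hxy => by
      have h1 := Metric.edist_le_ediam_of_mem (hf x hx).2 (hxy ▸ (hf y hy).2)
      have h2 := h1.trans (hdiam (f x))
      rw [(hf x hx).1, edist_dist] at h2
      exact (ENNReal.ofReal_le_ofReal_iff (by positivity)).1 h2)
  have hpow : ((1 / 2 : ℝ) ^ k) ^ (α + β) = ((1 / 2 : ℝ) ^ k) ^ s * r ^ k := by
    have h1 : r ^ k = ((1 / 2 : ℝ) ^ k) ^ (α + β - s) := by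
      rw [hr, ← Real.rpow_natCast, ← Real.rpow_mul (by norm_num), mul_comm,
        Real.rpow_mul (by norm_num), Real.rpow_natCast]
    rw [h1, ← Real.rpow_add (by positivity)]
    congr 1
    ring
  have hfinal : (1 : ℝ) ≤ K / (c₁ ^ 2 * c₂ * γ ^ 3) * ((k : ℝ) + 1) ^ 7 * r ^ k := by
    calc (1 : ℝ) ≤ _ := hmain
      _ ≤ 1 / ((1 / 2 : ℝ) ^ k) ^ s * ((k + 1) * (K / ((c₁ * p k) ^ 2 * (c₂ * p k)) *
          ((1 / 2) ^ k) ^ (α + β))) := by gcongr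
      _ = _ := by
        rw [hpow, hpdef]
        generalize ((1 / 2 : ℝ) ^ k) ^ s = y at hxs
        have hk1 : (k : ℝ) + 1 ≠ 0 := by positivity
        field_simp
  exact absurd hfinal (not_le.2 (hk₀ k hkk₀))

end Dimension

end Furstenberg

theorem theoremA1 (n : ℕ) (α β : ℝ) (hα : α ∈ Set.Ioc (0 : ℝ) 1)
    (hβ : β ∈ Set.Ioc (0 : ℝ) (2 * (n : ℝ) - 2))
    (E : Set (EuclideanSpace ℝ (Fin n))) (hE : Furstenberg.IsFurstenbergSet α β E) :
    ENNReal.ofReal (α + min β α) ≤ dimH E := by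
  have hE' : Furstenberg.IsFurstenbergSet α (min β α) E := by
    obtain ⟨L, hL, hLE⟩ := hE
    exact ⟨L, hL.trans_le (Measure.hausdorffMeasure_mono (min_le_left _ _) L), hLE⟩
  have hmin : 0 < min β α := lt_min hβ.1 hα.1
  by_contra! hlt
  -- Any `s` strictly above the dimension has `μH[s] E = 0`, and this one is below `α + min β α`.
  obtain ⟨s, hs1, hs2⟩ := ENNReal.lt_iff_exists_nnreal_btwn.1 hlt
  have hs0 : (0 : ℝ) < s :=
    NNReal.coe_pos.2 (ENNReal.coe_pos.1 (lt_of_le_of_lt zero_le hs1))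
  have h := Furstenberg.add_le_of_hausdorffMeasure_eq_zero hα.1 hmin (min_le_right _ _) hE' hs0
    (hausdorffMeasure_of_dimH_lt hs1)
  rw [← ENNReal.ofReal_coe_nnreal, ENNReal.ofReal_lt_ofReal_iff (by linarith [hα.1])] at hs2
  linarith
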